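/- Let $m\ge 1$ and $L\ge 1$. Consider $m$ bosonic modes with annihilation operators $\hat a_1,\dots,\hat a_m$, Fock states $|\boldsymbol n\rangle$ ($\boldsymbol n\in\mathbb N^m$, $|\boldsymbol n|=\sum_k n_k$) and number operator $\hat N=\sum_k \hat a_k^\dagger \hat a_k$, so that $\langle\psi|\hat N|\psi\rangle=\sum_{\boldsymbol n}|\boldsymbol n|\,|\psi_{\boldsymbol n}|^2\in[0,\infty]$ for $|\psi\rangle=\sum_{\boldsymbol n}\psi_{\boldsymbol n}|\boldsymbol n\rangle$. A unitary is called energy preserving if it commutes with $\hat N$. A Gaussian unitary is a product of unitaries $e^{-i\hat H}$ whose Hamiltonians $\hat H$ are Hermitian polynomials of degree at most $2$ in the operators $\hat a_k,\hat a_k^\dagger$. Let $$|\psi\rangle=\hat G_L\hat\chi_L\hat G_{L-1}\hat\chi_{L-1}\cdots\hat G_1\hat\chi_1|0\rangle^{\otimes m},$$ where $\hat\chi_1,\dots,\hat\chi_L$ are energy-preserving unitaries (not necessarily Gaussian) and each $\hat G_i$ is a Gaussian unitary of the form $$\hat G_i=\hat V_i\,\hat D(\boldsymbol\alpha_i)\,\hat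 S(\boldsymbol r_i)\,\hat U_i ,$$ with energy-preserving Gaussian unitaries $\hat U_i,\hat V_i$, a displacement vector $\boldsymbol\alpha_i\in\mathbb C^m$, a squeezing vector $\boldsymbol r_i\in[0,\infty)^m$, $\hat D(\boldsymbol\alpha)=\exp\big(\sum_k(\alpha_k\hat a_k^\dagger-\alpha_k^*\hat a_k)\big)$ and $\hat S(\boldsymbol r)=\exp\big(\tfrac12\sum_k r_k(\hat a_k^{\dagger 2}-\hat a_k^2)\big)$. Put $$|\alpha|:=\max_{i,k}|\alpha_{ik}|,\qquad r:=\max_{i,k}r_{ik},\qquad A:=e^{2r}+4|\alpha|e^{r}.$$ Then $$\langle\psi|\hat N|\psi\rangle\le m\,(A^L-1)\left(1+\frac{|\alpha|^2}{A-1}\right),$$ where for $A=1$ (that is, $|\alpha|=r=0$) the right-hand side is read as $0$. In particular the mean energy is finite. -/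

import Mathlib

open scoped ENNReal ComplexConjugate

noncomputable section

namespace Bosonic

/-- Occupation numbers `n = (n₁, …, n_m) ∈ ℕ^m`. -/
abbrev Occ (m : ℕ) := Fin m → ℕ

/-- Total boson number `|n| = n₁ + ⋯ + n_m`. -/
def Occ.total {m : ℕ} (n : Occ m) : ℕ := ∑ k, n k

/-- The Hilbert space of `m` bosonic modes, `ℓ²(ℕ^m)`: the vector `ψ` has Fock amplitudes `ψ n`. -/
abbrev FockSpace (m : ℕ) := lp (fun _ : Occ m => ℂ) 2

/-- Unitary operators of the `m`-mode Hilbert space, a group under composition. -/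
abbrev FockUnitary (m : ℕ) := FockSpace m ≃ₗᵢ[ℂ] FockSpace m

/-- The Fock state `|n⟩`. -/
def fockState {m : ℕ} (n : Occ m) : FockSpace m := lp.single 2 n (1 : ℂ)

/-- The vacuum `|0⟩^{⊗ m}`. -/
def vacuum (m : ℕ) : FockSpace m := fockState 0

/-- Finite superpositions of Fock states. -/
abbrev FiniteVec (m : ℕ) := Occ m →₀ ℂ

/-- The inclusion of the finite superpositions of Fock states into the Hilbert space. -/
def toFock (m : ℕ) : FiniteVec m →ₗ[ℂ] FockSpace m := Finsupp.linearCombination ℂ fockState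

/-- The annihilation operator of mode `k`: `a_k |n⟩ = √(n_k) |n - e_k⟩`. -/
def annihilation {m : ℕ} (k : Fin m) : Module.End ℂ (FiniteVec m) :=
  Finsupp.linearCombination ℂ fun n =>
    Finsupp.single (n - Pi.single k 1) ((Real.sqrt (n k) : ℝ) : ℂ)

/-- The creation operator of mode `k`: `a_k† |n⟩ = √(n_k + 1) |n + e_k⟩`. -/
def creation {m : ℕ} (k : Fin m) : Module.End ℂ (FiniteVec m) :=
  Finsupp.linearCombination ℂ fun n =>
    Finsupp.single (n + Pi.single k 1) ((Real.sqrt (n k + 1) : ℝ) : ℂ)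

/-- The total number operator `N`, with its natural domain
`{ψ : ∑ₙ |n|² |ψₙ|² < ∞}`, acting by `(N ψ)ₙ = |n| ψₙ`. -/
def numberOp (m : ℕ) : FockSpace m →ₗ.[ℂ] FockSpace m where
  domain :=
    { carrier := {ψ | Memℓp (fun n : Occ m => (n.total : ℂ) * ψ n) 2}
      add_mem' := by
        intro x y hx hy
        have h := Memℓp.add hx hy
        simp only [Set.mem_ofPred_eq]
        convert h using 1
        funext n
        simp [mul_add]
      zero_mem' := by
        simp only [Set.mem_ofPred_eq]
        convert (zero_memℓp : Memℓp (0 : Occ m → ℂ) 2) using 1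
        funext n
        simp
      smul_mem' := by
        intro c x hx
        have h := Memℓp.const_smul hx c
        simp only [Set.mem_ofPred_eq]
        convert h using 1
        funext n
        simp [mul_left_comm] }
  toFun :=
    { toFun := fun ψ => ⟨fun n : Occ m => (n.total : ℂ) * (ψ : FockSpace m) n, ψ.2⟩
      map_add' := by
        intro x y
        ext n
        exact mul_add _ _ _
      map_smul' := by
        intro c x
        ext n
        exact mul_left_comm _ _ _ }

/-- The mean energy `⟨ψ|N|ψ⟩ = ∑ₙ |n| |ψₙ|²`, in `[0, ∞]`; it is `∞` when the series diverges. -/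
def meanEnergy {m : ℕ} (ψ : FockSpace m) : ℝ≥0∞ :=
  ∑' n : Occ m, (n.total : ℝ≥0∞) * ‖ψ n‖ₑ ^ 2

/-- The unitary `W` is energy preserving: it commutes with `N`, that is, it maps the domain of `N`
into itself and `N W ψ = W N ψ` there. -/
def IsEnergyPreserving {m : ℕ} (W : FockUnitary m) : Prop :=
  ∀ ψ : (numberOp m).domain, ∃ h : W (ψ : FockSpace m) ∈ (numberOp m).domain,
    numberOp m ⟨W (ψ : FockSpace m), h⟩ = W (numberOp m ψ)

/-- `W = exp K`, where `K` is given on finite superpositions of Fock states: `W` is the value at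
time `1` of a strongly continuous one-parameter unitary group `t ↦ exp (t K)` whose generator
extends `K`. For an anti-Hermitian `K` that is of degree at most two in the `a_k`, `a_k†`, finite
superpositions form a core of the generator, so that there is exactly one such group. -/
def IsExp {m : ℕ} (K : Module.End ℂ (FiniteVec m)) (W : FockUnitary m) : Prop :=
  ∃ U : ℝ → FockUnitary m,
    U 0 = 1 ∧ (∀ s t, U (s + t) = U s * U t) ∧ (∀ ψ, Continuous fun t => U t ψ) ∧
    (∀ φ, HasDerivAt (fun t => U t (toFock m φ)) (toFock m (K φ)) 0) ∧
    U 1 = W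

/-- The displacement operator `D(α) = exp (∑ₖ (αₖ aₖ† - αₖ* aₖ))`. -/
def IsDisplacement {m : ℕ} (α : Fin m → ℂ) (D : FockUnitary m) : Prop :=
  IsExp (∑ k, (α k • creation k - conj (α k) • annihilation k)) D

/-- The squeezing operator `S(ξ) = exp (½ ∑ₖ (ξₖ aₖ†² - ξₖ* aₖ²))`. For real `ξ = r` it acts on the
quadratures by `S† qₖ S = e^{rₖ} qₖ` and `S† pₖ S = e^{-rₖ} pₖ`. -/
def IsSqueezing {m : ℕ} (ξ : Fin m → ℂ) (S : FockUnitary m) : Prop :=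
  IsExp ((1 / 2 : ℂ) • ∑ k, (ξ k • creation k ^ 2 - conj (ξ k) • annihilation k ^ 2)) S

/-- Polynomials of degree at most two in the creation and annihilation operators. -/
def quadraticOps (m : ℕ) : Submodule ℂ (Module.End ℂ (FiniteVec m)) :=
  Submodule.span ℂ (insert 1 (Set.range annihilation ∪ Set.range creation)) ^ 2

/-- A quadratic Hamiltonian: a Hermitian polynomial of degree at most two in the creation and
annihilation operators. -/
def IsQuadraticHamiltonian {m : ℕ} (H : Module.End ℂ (FiniteVec m)) : Prop :=
  H ∈ quadraticOps m ∧
    ∀ φ φ', inner ℂ (toFock m (H φ)) (toFock m φ') = inner ℂ (toFock m φ) (toFock m (H φ'))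

/-- The Gaussian unitaries: products of unitaries `exp (-i H)` with quadratic Hamiltonians `H`. -/
def gaussianUnitaries (m : ℕ) : Submonoid (FockUnitary m) :=
  Submonoid.closure {W | ∃ H, IsQuadraticHamiltonian H ∧ IsExp (-Complex.I • H) W}

/-- Passive Gaussian unitaries: the energy-preserving ones. -/
def IsPassive {m : ℕ} (W : FockUnitary m) : Prop :=
  W ∈ gaussianUnitaries m ∧ IsEnergyPreserving W

/-- `G` is a Gaussian unitary with displacement vector `α ∈ ℂ^m` and squeezing vector
`r ∈ ℝ₊^m`: it has a decomposition `G = V D(α) S(r) U` with passive `V` and `U`. -/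
def IsGaussianGate {m : ℕ} (α : Fin m → ℂ) (r : Fin m → ℝ) (G : FockUnitary m) : Prop :=
  G ∈ gaussianUnitaries m ∧ (∀ k, 0 ≤ r k) ∧
    ∃ V D S U : FockUnitary m, IsPassive V ∧ IsDisplacement α D ∧
      IsSqueezing (fun k => (r k : ℂ)) S ∧ IsPassive U ∧ G = V * D * S * U

/-- The state `G_L χ_L ⋯ G_1 χ_1 |0⟩^{⊗ m}` (layer `1` is indexed by `0 : Fin L`). -/
def circuitState {m L : ℕ} (G χ : Fin L → FockUnitary m) : FockSpace m :=
  Fin.foldl L (fun ψ i => G i (χ i ψ)) (vacuum m)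

/-- The output states of the `m`-mode circuits of depth `L` whose Gaussian gates have displacement
vectors `α i` and squeezing vectors `r i`, and whose other gates are energy-preserving unitaries. -/
def outputStates {m L : ℕ} (α : Fin L → Fin m → ℂ) (r : Fin L → Fin m → ℝ) :
    Set (FockSpace m) :=
  {ψ | ∃ G χ : Fin L → FockUnitary m, (∀ i, IsGaussianGate (α i) (r i) (G i)) ∧
    (∀ i, IsEnergyPreserving (χ i)) ∧ ψ = circuitState G χ}

end Bosonic

end

noncomputable section

namespace Bosonic

/-! ### Fock amplitudes -/

/-! Energy-preserving unitaries leave the mean energy unchanged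
(`IsEnergyPreserving.meanEnergy_map`), so only squeezings and displacements matter. Write `E` for
the energy along the flow `t ↦ exp (t K)`, with `a` bounding the displacements and `R` the
squeezings. A squeezing obeys `E' ≤ 2R E + R m`, so `E + m/2` grows at most by the factor `e^{2R}`
(`IsSqueezing.cappedEnergy_le`). A displacement raises `√(E + m)` by at most `a √m`
(`IsDisplacement.cappedEnergy_le`).

As `N` is unbounded and finiteness of the energy is part of the claim, `E` cannot be differentiated
directly. It is replaced by `∑ₙ min(|n|, M) |ψₙ|²`, which for constant norm depends on finitely many
amplitudes and is differentiable for every initial vector. The differential inequalities hold with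
constants independent of `M ≥ 1`, and `M` is released at the end.

One layer then turns an energy bound `X` into `A (X + m) - m + m a²` (`meanEnergy_layer_le`);
iterating from `X = 0` gives a geometric sum. -/

lemma inner_fockState {m : ℕ} (n : Occ m) (ψ : FockSpace m) : inner ℂ (fockState n) ψ = ψ n := by
  rw [fockState, lp.inner_single_left]
  simp

lemma fockState_apply {m : ℕ} (n n' : Occ m) :
    fockState n n' = if n' = n then (1 : ℂ) else 0 := by
  by_cases h : n' = n
  · subst h
    rw [fockState, lp.single_apply_self, if_pos rfl]
  · rw [fockState, lp.single_apply_ne _ _ _ h, if_neg h]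

lemma hasSum_norm_sq {m : ℕ} (ψ : FockSpace m) : HasSum (fun n => ‖ψ n‖ ^ 2) (‖ψ‖ ^ 2) := by
  have h := lp.hasSum_norm (p := 2) (by norm_num) ψ
  simpa using h

lemma hasSum_fockState {m : ℕ} (ψ : FockSpace m) : HasSum (fun n => ψ n • fockState n) ψ := by
  convert lp.hasSum_single (by norm_num) ψ using 2 with n
  rw [fockState, ← lp.single_smul, smul_eq_mul, mul_one]

lemma tsum_enorm_sq {m : ℕ} (ψ : FockSpace m) :
    ∑' n, ‖ψ n‖ₑ ^ 2 = ENNReal.ofReal (‖ψ‖ ^ 2) := by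
  rw [← (hasSum_norm_sq ψ).tsum_eq,
    ENNReal.ofReal_tsum_of_nonneg (fun n => sq_nonneg _) (hasSum_norm_sq ψ).summable]
  refine tsum_congr fun n => ?_
  rw [ENNReal.ofReal_pow (norm_nonneg _), ofReal_norm]

@[simp] lemma norm_vacuum (m : ℕ) : ‖vacuum m‖ = 1 := by
  rw [vacuum, fockState, lp.norm_single (by norm_num)]
  simp

lemma meanEnergy_vacuum (m : ℕ) : meanEnergy (vacuum m) = 0 := by
  rw [meanEnergy, ENNReal.tsum_eq_zero]
  intro n
  rw [vacuum, fockState_apply]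
  split_ifs with h
  · simp [h, Occ.total]
  · simp

/-- The occupation numbers below a given total number form a finite set. -/
lemma finite_setOf_total_lt (m M : ℕ) : {n : Occ m | n.total < M}.Finite := by
  refine (Set.finite_Iic (fun _ : Fin m => M)).subset fun n hn k => ?_
  exact (Finset.single_le_sum (f := n) (fun _ _ => Nat.zero_le _) (Finset.mem_univ k)).trans
    (le_of_lt hn)

/-! ### Energy-preserving unitaries -/

lemma fockState_mem_domain {m : ℕ} (n : Occ m) : fockState n ∈ (numberOp m).domain := by
  change Memℓp (fun n' : Occ m => (n'.total : ℂ) * fockState n n') 2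
  have h := lp.memℓp ((n.total : ℂ) • fockState n)
  convert h using 1
  funext n'
  rw [lp.coeFn_smul, Pi.smul_apply, smul_eq_mul, fockState_apply]
  split_ifs with h
  · rw [h]
  · simp

lemma numberOp_fockState {m : ℕ} (n : Occ m) :
    numberOp m ⟨fockState n, fockState_mem_domain n⟩ = (n.total : ℂ) • fockState n := by
  ext n'
  change (n'.total : ℂ) * fockState n n' = _
  rw [lp.coeFn_smul, Pi.smul_apply, smul_eq_mul, fockState_apply]
  split_ifs with h
  · rw [h]
  · simp

/-- `W |n⟩` is again an eigenvector of `N` with eigenvalue `|n|`, so it has no amplitude at other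
total numbers. -/
lemma IsEnergyPreserving.apply_fockState {m : ℕ} {W : FockUnitary m} (hW : IsEnergyPreserving W)
    {n n' : Occ m} (h : n.total ≠ n'.total) : W (fockState n) n' = 0 := by
  obtain ⟨hd, he⟩ := hW ⟨fockState n, fockState_mem_domain n⟩
  rw [numberOp_fockState, map_smul] at he
  have h2 := congrArg (fun φ : FockSpace m => φ n') he
  change (n'.total : ℂ) * W (fockState n) n' = (n.total : ℂ) * W (fockState n) n' at h2
  have h3 : ((n.total : ℂ) - n'.total) * W (fockState n) n' = 0 := by rw [sub_mul, h2, sub_self]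
  refine (mul_eq_zero.mp h3).resolve_left (sub_ne_zero.mpr ?_)
  exact_mod_cast h

/-- The component of total number `j` of a vector. -/
def levelPart {m : ℕ} (j : ℕ) (ψ : FockSpace m) : FockSpace m :=
  ⟨fun n => if n.total = j then ψ n else 0, Memℓp.mono' (lp.memℓp ψ) fun n => by
    split_ifs <;> simp⟩

lemma levelPart_apply {m : ℕ} (j : ℕ) (ψ : FockSpace m) (n : Occ m) :
    levelPart j ψ n = if n.total = j then ψ n else 0 := rfl

lemma hasSum_map_apply {m : ℕ} (W : FockUnitary m) (ψ : FockSpace m) (n' : Occ m) :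
    HasSum (fun n => ψ n * W (fockState n) n') (W ψ n') := by
  have h := (hasSum_fockState ψ).mapL
    ((lp.evalCLM ℂ (fun _ : Occ m => ℂ) 2 n').comp (W : FockSpace m →L[ℂ] FockSpace m))
  have e (n : Occ m) : ψ n * W (fockState n) n' = W (ψ n • fockState n) n' := by
    rw [map_smul]
    rfl
  simp_rw [e]
  exact h

lemma IsEnergyPreserving.map_levelPart {m : ℕ} {W : FockUnitary m} (hW : IsEnergyPreserving W)
    (j : ℕ) (ψ : FockSpace m) : W (levelPart j ψ) = levelPart j (W ψ) := by
  ext n'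
  have h1 := hasSum_map_apply W (levelPart j ψ) n'
  have h2 := hasSum_map_apply W ψ n'
  rw [levelPart_apply]
  split_ifs with h
  · refine h1.unique ?_
    convert h2 using 2 with n
    rw [levelPart_apply]
    split_ifs with h3
    · rfl
    · rw [hW.apply_fockState (by omega), mul_zero, mul_zero]
  · refine h1.unique ?_
    convert hasSum_zero using 2 with n
    rw [levelPart_apply]
    split_ifs with h3
    · rw [hW.apply_fockState (by omega), mul_zero]
    · rw [zero_mul]

lemma meanEnergy_eq_tsum_level {m : ℕ} (ψ : FockSpace m) :
    meanEnergy ψ = ∑' j : ℕ, (j : ℝ≥0∞) * ENNReal.ofReal (‖levelPart j ψ‖ ^ 2) := by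
  have h (n : Occ m) : (n.total : ℝ≥0∞) * ‖ψ n‖ₑ ^ 2 =
      ∑' j : ℕ, (j : ℝ≥0∞) * ‖levelPart j ψ n‖ₑ ^ 2 := by
    rw [tsum_eq_single n.total]
    · rw [levelPart_apply, if_pos rfl]
    · intro j hj
      rw [levelPart_apply, if_neg hj.symm]
      simp
  simp_rw [meanEnergy, h]
  rw [ENNReal.tsum_comm]
  simp_rw [ENNReal.tsum_mul_left, tsum_enorm_sq]

/-- `W` acts isometrically inside each level of fixed total number, and the energy depends only on
the norms of the level components. Infinite energy is covered as well. -/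
theorem IsEnergyPreserving.meanEnergy_map {m : ℕ} {W : FockUnitary m} (hW : IsEnergyPreserving W)
    (ψ : FockSpace m) : meanEnergy (W ψ) = meanEnergy ψ := by
  simp_rw [meanEnergy_eq_tsum_level, ← hW.map_levelPart, LinearIsometryEquiv.norm_map]

/-! ### Truncated energies -/

/-- The energy capped at `M` particles: `∑ₙ min (|n|) M |ψₙ|²`. -/
def cappedEnergy {m : ℕ} (M : ℕ) (ψ : FockSpace m) : ℝ :=
  ∑' n : Occ m, (min n.total M : ℕ) * ‖ψ n‖ ^ 2

lemma summable_cappedEnergy {m : ℕ} (M : ℕ) (ψ : FockSpace m) :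
    Summable fun n : Occ m => ((min n.total M : ℕ) : ℝ) * ‖ψ n‖ ^ 2 := by
  refine Summable.of_nonneg_of_le (fun n => by positivity) (fun n => ?_)
    ((hasSum_norm_sq ψ).summable.mul_left (M : ℝ))
  gcongr
  exact min_le_right _ _

lemma cappedEnergy_nonneg {m : ℕ} (M : ℕ) (ψ : FockSpace m) : 0 ≤ cappedEnergy M ψ :=
  tsum_nonneg fun _ => by positivity

lemma ofReal_cappedEnergy {m : ℕ} (M : ℕ) (ψ : FockSpace m) :
    ENNReal.ofReal (cappedEnergy M ψ) =
      ∑' n : Occ m, ((min n.total M : ℕ) : ℝ≥0∞) * ‖ψ n‖ₑ ^ 2 := by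
  rw [cappedEnergy, ENNReal.ofReal_tsum_of_nonneg (fun n => by positivity)
    (summable_cappedEnergy M ψ)]
  refine tsum_congr fun n => ?_
  rw [ENNReal.ofReal_mul (by positivity), ENNReal.ofReal_natCast,
    ENNReal.ofReal_pow (norm_nonneg _), ofReal_norm]

lemma cappedEnergy_le {m : ℕ} (M : ℕ) {ψ : FockSpace m} {X : ℝ} (hX : 0 ≤ X)
    (h : meanEnergy ψ ≤ ENNReal.ofReal X) : cappedEnergy M ψ ≤ X := by
  rw [← ENNReal.ofReal_le_ofReal_iff hX, ofReal_cappedEnergy]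
  refine le_trans (ENNReal.tsum_le_tsum fun n => ?_) h
  gcongr
  exact min_le_left _ _

/-- Monotone convergence: the cap is invisible to any finite set of Fock states once `M` exceeds
their total numbers. -/
lemma meanEnergy_le_of_cappedEnergy_le {m : ℕ} {ψ : FockSpace m} {X : ℝ}
    (h : ∀ M, 1 ≤ M → cappedEnergy M ψ ≤ X) : meanEnergy ψ ≤ ENNReal.ofReal X := by
  refine ENNReal.summable.tsum_le_of_sum_le fun s => ?_
  have h1 := ENNReal.ofReal_le_ofReal (h (s.sup Occ.total + 1) (by omega))
  rw [ofReal_cappedEnergy] at h1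
  refine le_trans (le_trans (Finset.sum_le_sum fun n hn => ?_) (ENNReal.sum_le_tsum s)) h1
  have h2 : n.total ≤ s.sup Occ.total := Finset.le_sup hn
  rw [min_eq_left (by omega)]

/-- Since `min(|n|, M) = M - (M - |n|)` with truncated subtraction, the series becomes a conserved
norm minus a finite sum, which can be differentiated term by term. -/
lemma cappedEnergy_eq {m : ℕ} (M : ℕ) (ψ : FockSpace m) :
    cappedEnergy M ψ = M * ‖ψ‖ ^ 2 -
      ∑ n ∈ (finite_setOf_total_lt m M).toFinset, ((M - n.total : ℕ) : ℝ) * ‖ψ n‖ ^ 2 := by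
  have h1 : HasSum (fun n : Occ m => ((M - n.total : ℕ) : ℝ) * ‖ψ n‖ ^ 2)
      (∑ n ∈ (finite_setOf_total_lt m M).toFinset, ((M - n.total : ℕ) : ℝ) * ‖ψ n‖ ^ 2) := by
    refine hasSum_sum_of_ne_finset_zero fun n hn => ?_
    have : M ≤ n.total := by simpa using hn
    simp [Nat.sub_eq_zero_of_le this]
  rw [← (((hasSum_norm_sq ψ).mul_left (M : ℝ)).sub h1).tsum_eq, cappedEnergy]
  refine tsum_congr fun n => ?_
  rw [← sub_mul]
  congr 1
  rw [eq_sub_iff_add_eq]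
  norm_cast
  omega

/-! ### Evolution of the capped energy -/

lemma toFock_single {m : ℕ} (n : Occ m) : toFock m (Finsupp.single n 1) = fockState n := by
  rw [toFock, Finsupp.linearCombination_single, one_smul]

/-- Weak Schrödinger equation: it holds for every initial vector, since finite superpositions may be
evolved backwards. -/
lemma hasDerivAt_inner_toFock {m : ℕ} {K : Module.End ℂ (FiniteVec m)} {U : ℝ → FockUnitary m}
    (hadd : ∀ s t, U (s + t) = U s * U t)
    (hd : ∀ φ, HasDerivAt (fun t => U t (toFock m φ)) (toFock m (K φ)) 0)
    (φ : FiniteVec m) (ψ : FockSpace m) (t : ℝ) :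
    HasDerivAt (fun s => inner ℂ (toFock m φ) (U s ψ))
      (-inner ℂ (toFock m (K φ)) (U t ψ)) t := by
  have h1 (s : ℝ) : inner ℂ (toFock m φ) (U s ψ) = inner ℂ (U (t - s) (toFock m φ)) (U t ψ) := by
    rw [← (U (t - s)).inner_map_map (toFock m φ) (U s ψ)]
    have h2 : U t = U (t - s) * U s := by rw [← hadd, sub_add_cancel]
    rw [h2]
    rfl
  simp_rw [h1]
  have h3 : HasDerivAt (fun s => U (t - s) (toFock m φ)) (-toFock m (K φ)) t := by
    have h4 := (hd φ)
    rw [← sub_self t] at h4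
    have h5 := h4.scomp t ((hasDerivAt_id t).const_sub t)
    rw [neg_one_smul] at h5
    exact h5
  simpa using h3.inner ℂ (hasDerivAt_const t (U t ψ))

/-- The rate of change of the energy capped at `M` particles under the evolution generated by
`K`. -/
def cappedRate {m : ℕ} (M : ℕ) (K : Module.End ℂ (FiniteVec m)) (ψ : FockSpace m) : ℝ :=
  ∑ n ∈ (finite_setOf_total_lt m M).toFinset, ((M - n.total : ℕ) : ℝ) *
    (2 * (starRingEnd ℂ (ψ n) * inner ℂ (toFock m (K (Finsupp.single n 1))) ψ).re)

lemma hasDerivAt_cappedEnergy {m : ℕ} {K : Module.End ℂ (FiniteVec m)} {U : ℝ → FockUnitary m}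
    (hadd : ∀ s t, U (s + t) = U s * U t)
    (hd : ∀ φ, HasDerivAt (fun t => U t (toFock m φ)) (toFock m (K φ)) 0)
    (M : ℕ) (ψ : FockSpace m) (t : ℝ) :
    HasDerivAt (fun s => cappedEnergy M (U s ψ)) (cappedRate M K (U t ψ)) t := by
  simp_rw [cappedEnergy_eq, LinearIsometryEquiv.norm_map]
  have h1 (n : Occ m) : HasDerivAt (fun s => ‖U s ψ n‖ ^ 2)
      (-(2 * (starRingEnd ℂ (U t ψ n) * inner ℂ (toFock m (K (Finsupp.single n 1))) (U t ψ)).re)) t := by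
    have h2 := hasDerivAt_inner_toFock hadd hd (Finsupp.single n 1) ψ t
    simp_rw [toFock_single, inner_fockState] at h2
    convert h2.norm_sq using 1
    rw [Complex.inner]
    simp
    ring
  have h3 := (HasDerivAt.fun_sum (u := (finite_setOf_total_lt m M).toFinset) fun n _ =>
    (h1 n).const_mul ((M - n.total : ℕ) : ℝ)).const_sub (M * ‖ψ‖ ^ 2)
  refine h3.congr_deriv ?_
  rw [cappedRate, ← Finset.sum_neg_distrib]
  exact Finset.sum_congr rfl fun n _ => by ring

/-- The operator `K` is `∑ₖ (cₖ Bₖ - cₖ* Bₖ†)`, where `Bₖ |n⟩ = wₖ(n) |n + eₖ⟩`, and `wₖ'(n)` are the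
matrix elements of `Bₖ†`. -/
structure IsHopping {m : ℕ} (K : Module.End ℂ (FiniteVec m)) (e : Fin m → Occ m) (c : Fin m → ℂ)
    (w w' : Fin m → Occ m → ℝ) : Prop where
  apply_single : ∀ n, K (Finsupp.single n 1) =
    ∑ k, ((c k * w k n) • Finsupp.single (n + e k) 1 -
      (conj (c k) * w' k n) • Finsupp.single (n - e k) 1)
  lower_add : ∀ k n, w' k (n + e k) = w k n
  -- Subtraction in `Occ` truncates; this removes the spurious terms where `n - e k` is not a
  -- genuine lowering.
  lower_eq_zero : ∀ k n, ¬ e k ≤ n → w' k n = 0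

lemma IsHopping.inner_eq {m : ℕ} {K : Module.End ℂ (FiniteVec m)} {e : Fin m → Occ m}
    {c : Fin m → ℂ} {w w' : Fin m → Occ m → ℝ} (h : IsHopping K e c w w') (n : Occ m)
    (ψ : FockSpace m) : inner ℂ (toFock m (K (Finsupp.single n 1))) ψ =
      ∑ k, (conj (c k) * w k n * ψ (n + e k) - c k * w' k n * ψ (n - e k)) := by
  rw [h.apply_single, map_sum, sum_inner]
  refine Finset.sum_congr rfl fun k _ => ?_
  rw [map_sub, map_smul, map_smul, toFock_single, toFock_single, inner_sub_left, inner_smul_left,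
    inner_smul_left, inner_fockState, inner_fockState]
  simp

/-- Summation by parts for one hopping term, followed by a weighted Young inequality. -/
lemma sum_hopping_le {m : ℕ} (ψ : FockSpace m) (e : Occ m) (c : ℂ) (w w' g p q : Occ m → ℝ)
    (S : Finset (Occ m)) (hg : ∀ n, n ∉ S → g n = 0) (hadd : ∀ n, w' (n + e) = w n)
    (hzero : ∀ n, ¬ e ≤ n → w' n = 0) (hp : ∀ n, 0 ≤ p n)
    (hps : Summable fun n => p n * ‖ψ n‖ ^ 2) (hqs : Summable fun n => q n * ‖ψ n‖ ^ 2)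
    (hpq : ∀ n x y, 0 ≤ x → 0 ≤ y →
      2 * (‖c‖ * |w n| * |g n - g (n + e)|) * x * y ≤ p (n + e) * x ^ 2 + q n * y ^ 2) :
    ∑ n ∈ S, g n * (2 * (starRingEnd ℂ (ψ n) *
      (conj c * w n * ψ (n + e) - c * w' n * ψ (n - e))).re) ≤
      ∑' n, (p n + q n) * ‖ψ n‖ ^ 2 := by
  have hinj : Function.Injective fun n : Occ m => n + e := add_left_injective e
  set a : Occ m → ℝ := fun n => g n * (2 * (starRingEnd ℂ (ψ n) * (conj c * w n * ψ (n + e))).re) with ha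
  set b : Occ m → ℝ := fun n => g n * (2 * (starRingEnd ℂ (ψ n) * (c * w' n * ψ (n - e))).re) with hb
  have ha0 : ∀ n, n ∉ S → a n = 0 := fun n hn => by simp [ha, hg n hn]
  have hb0 : ∀ n, n ∉ S → b n = 0 := fun n hn => by simp [hb, hg n hn]
  have has : Summable a := summable_of_ne_finset_zero fun n hn => ha0 n hn
  have hbs : Summable b := summable_of_ne_finset_zero fun n hn => hb0 n hn
  -- The shift by `e` misses only those `n` with `¬ e ≤ n`, where `b` vanishes.
  have hbe : ∑' n, b (n + e) = ∑' n, b n := by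
    refine hinj.tsum_eq fun n hn => ?_
    by_cases hle : e ≤ n
    · exact ⟨n - e, tsub_add_cancel_of_le hle⟩
    · exact absurd (by simp [hb, hzero n hle]) hn
  have hlhs : ∑ n ∈ S, g n * (2 * (starRingEnd ℂ (ψ n) *
      (conj c * w n * ψ (n + e) - c * w' n * ψ (n - e))).re) = ∑' n, (a n - b (n + e)) := by
    have hbs' : Summable fun n => b (n + e) := hbs.comp_injective hinj
    rw [has.tsum_sub hbs', hbe, tsum_eq_sum ha0, tsum_eq_sum hb0,
      ← Finset.sum_sub_distrib]
    refine Finset.sum_congr rfl fun n _ => ?_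
    rw [ha, hb, mul_sub, Complex.sub_re]
    ring
  have hterm (n : Occ m) : a n - b (n + e) ≤ p (n + e) * ‖ψ (n + e)‖ ^ 2 + q n * ‖ψ n‖ ^ 2 := by
    -- A transition and its reverse have the same real part, so only the discrete difference `g n -
    -- g (n + e)` survives.
    have h1 : (starRingEnd ℂ (ψ (n + e)) * (c * w n * ψ n)).re =
        (starRingEnd ℂ (ψ n) * (conj c * w n * ψ (n + e))).re := by
      rw [← Complex.conj_re]
      congr 1
      simp only [map_mul, Complex.conj_conj, Complex.conj_ofReal]
      ring
    have h2 : a n - b (n + e) =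
        2 * ((g n - g (n + e)) * (starRingEnd ℂ (ψ n) * (conj c * w n * ψ (n + e))).re) := by
      simp only [ha, hb, hadd, add_tsub_cancel_right, h1]
      ring
    rw [h2]
    refine le_trans ?_ (hpq n ‖ψ (n + e)‖ ‖ψ n‖ (norm_nonneg _) (norm_nonneg _))
    have h3 := (le_abs_self _).trans_eq
      (abs_mul (g n - g (n + e)) (starRingEnd ℂ (ψ n) * (conj c * w n * ψ (n + e))).re)
    have h4 := mul_le_mul_of_nonneg_left
      (Complex.abs_re_le_norm (starRingEnd ℂ (ψ n) * (conj c * w n * ψ (n + e))))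
      (abs_nonneg (g n - g (n + e)))
    simp only [norm_mul, RCLike.norm_conj, Complex.norm_real, Real.norm_eq_abs] at h4
    linarith
  have hpe : Summable fun n => p (n + e) * ‖ψ (n + e)‖ ^ 2 := hps.comp_injective hinj
  rw [hlhs]
  calc ∑' n, (a n - b (n + e))
      ≤ ∑' n, (p (n + e) * ‖ψ (n + e)‖ ^ 2 + q n * ‖ψ n‖ ^ 2) :=
        (has.sub (hbs.comp_injective hinj)).tsum_le_tsum hterm (hpe.add hqs)
    _ = ∑' n, p (n + e) * ‖ψ (n + e)‖ ^ 2 + ∑' n, q n * ‖ψ n‖ ^ 2 := hpe.tsum_add hqs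
    _ ≤ ∑' n, p n * ‖ψ n‖ ^ 2 + ∑' n, q n * ‖ψ n‖ ^ 2 := by
        refine add_le_add_left ?_ _
        exact tsum_comp_le_tsum_of_inj hps (fun n => mul_nonneg (hp n) (sq_nonneg _)) hinj
    _ = ∑' n, (p n + q n) * ‖ψ n‖ ^ 2 := by
        rw [← hps.tsum_add hqs]
        simp_rw [add_mul]

/-- Reduces the rate estimate to pointwise conditions: `p` and `q` are the Young weights at the
upper and lower end of a hop, and `hCD` bounds their total at each site. -/
lemma IsHopping.cappedRate_le {m : ℕ} {K : Module.End ℂ (FiniteVec m)} {e : Fin m → Occ m}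
    {c : Fin m → ℂ} {w w' : Fin m → Occ m → ℝ} (h : IsHopping K e c w w') (M : ℕ)
    (ψ : FockSpace m) (p q : Fin m → Occ m → ℝ) (C D : ℝ)
    (hp : ∀ k n, 0 ≤ p k n) (hq : ∀ k n, 0 ≤ q k n)
    (hpq : ∀ k n x y, 0 ≤ x → 0 ≤ y →
      2 * (‖c k‖ * |w k n| * |((M - n.total : ℕ) : ℝ) - (M - (n + e k).total : ℕ)|) * x * y ≤
        p k (n + e k) * x ^ 2 + q k n * y ^ 2)
    (hCD : ∀ n, ∑ k, (p k n + q k n) ≤ C * (min n.total M : ℕ) + D) :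
    cappedRate M K ψ ≤ C * cappedEnergy M ψ + D * ‖ψ‖ ^ 2 := by
  have hsum : HasSum (fun n : Occ m => (C * (min n.total M : ℕ) + D) * ‖ψ n‖ ^ 2)
      (C * cappedEnergy M ψ + D * ‖ψ‖ ^ 2) := by
    simp_rw [add_mul, mul_assoc]
    exact ((summable_cappedEnergy M ψ).hasSum.mul_left C).add ((hasSum_norm_sq ψ).mul_left D)
  have hle (k : Fin m) (n : Occ m) : p k n + q k n ≤ C * (min n.total M : ℕ) + D :=
    (Finset.single_le_sum (f := fun k => p k n + q k n)
      (fun k _ => add_nonneg (hp k n) (hq k n)) (Finset.mem_univ k)).trans (hCD n)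
  have hps (k : Fin m) : Summable fun n => p k n * ‖ψ n‖ ^ 2 :=
    hsum.summable.of_nonneg_of_le (fun n => mul_nonneg (hp k n) (sq_nonneg _)) fun n =>
      mul_le_mul_of_nonneg_right (by linarith [hle k n, hq k n]) (sq_nonneg _)
  have hqs (k : Fin m) : Summable fun n => q k n * ‖ψ n‖ ^ 2 :=
    hsum.summable.of_nonneg_of_le (fun n => mul_nonneg (hq k n) (sq_nonneg _)) fun n =>
      mul_le_mul_of_nonneg_right (by linarith [hle k n, hp k n]) (sq_nonneg _)
  have hpqs (k : Fin m) : Summable fun n => (p k n + q k n) * ‖ψ n‖ ^ 2 := by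
    simp_rw [add_mul]
    exact (hps k).add (hqs k)
  have hsplit : cappedRate M K ψ = ∑ k, ∑ n ∈ (finite_setOf_total_lt m M).toFinset,
      ((M - n.total : ℕ) : ℝ) * (2 * (starRingEnd ℂ (ψ n) *
        (conj (c k) * w k n * ψ (n + e k) - c k * w' k n * ψ (n - e k))).re) := by
    rw [cappedRate, Finset.sum_comm]
    refine Finset.sum_congr rfl fun n _ => ?_
    rw [h.inner_eq, Finset.mul_sum, Complex.re_sum, Finset.mul_sum, Finset.mul_sum]
  rw [hsplit]
  calc _ ≤ ∑ k, ∑' n, (p k n + q k n) * ‖ψ n‖ ^ 2 := by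
        refine Finset.sum_le_sum fun k _ => ?_
        refine sum_hopping_le ψ (e k) (c k) (w k) (w' k) (fun n => ((M - n.total : ℕ) : ℝ))
          (p k) (q k) _ (fun n hn => ?_) (h.lower_add k) (h.lower_eq_zero k) (hp k) (hps k) (hqs k)
          (hpq k)
        have : M ≤ n.total := by simpa using hn
        simp [Nat.sub_eq_zero_of_le this]
    _ = ∑' n, ∑ k, (p k n + q k n) * ‖ψ n‖ ^ 2 :=
        (Summable.tsum_finsetSum fun k _ => hpqs k).symm
    _ ≤ _ := by
        rw [← hsum.tsum_eq]
        refine (summable_sum fun k _ => hpqs k).tsum_le_tsum (fun n => ?_) hsum.summable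
        rw [← Finset.sum_mul]
        exact mul_le_mul_of_nonneg_right (hCD n) (sq_nonneg _)

/-! ### Displacements and squeezings -/

lemma total_add_single {m : ℕ} (n : Occ m) (k : Fin m) (d : ℕ) :
    (n + Pi.single k d : Occ m).total = n.total + d := by
  simp [Occ.total, Finset.sum_add_distrib]

lemma not_single_le {m : ℕ} {n : Occ m} {k : Fin m} {d : ℕ}
    (h : ¬ (Pi.single k d : Occ m) ≤ n) : n k < d := by
  by_contra! hd
  refine h fun j => ?_
  by_cases hj : j = k
  · subst hj
    simpa using hd
  · simp [Pi.single_eq_of_ne hj]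

lemma creation_single {m : ℕ} (k : Fin m) (n : Occ m) :
    creation k (Finsupp.single n 1) =
      ((Real.sqrt (n k + 1) : ℝ) : ℂ) • Finsupp.single (n + Pi.single k 1) 1 := by
  rw [creation, Finsupp.linearCombination_single, one_smul, Finsupp.smul_single, smul_eq_mul,
    mul_one]

lemma annihilation_single {m : ℕ} (k : Fin m) (n : Occ m) :
    annihilation k (Finsupp.single n 1) =
      ((Real.sqrt (n k) : ℝ) : ℂ) • Finsupp.single (n - Pi.single k 1) 1 := by
  rw [annihilation, Finsupp.linearCombination_single, one_smul, Finsupp.smul_single, smul_eq_mul,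
    mul_one]

lemma isHopping_displacement {m : ℕ} (α : Fin m → ℂ) :
    IsHopping (∑ k, (α k • creation k - conj (α k) • annihilation k)) (fun k => Pi.single k 1) α
      (fun k n => Real.sqrt (n k + 1)) (fun k n => Real.sqrt (n k)) where
  apply_single n := by
    simp only [LinearMap.sum_apply, LinearMap.sub_apply, LinearMap.smul_apply, creation_single,
      annihilation_single, smul_smul]
  lower_add k n := by simp
  lower_eq_zero k n h := by
    have := not_single_le h
    simp [show n k = 0 by omega]

lemma isHopping_squeezing {m : ℕ} (r : Fin m → ℝ) :
    IsHopping ((1 / 2 : ℂ) • ∑ k, ((r k : ℂ) • creation k ^ 2 - conj (r k : ℂ) • annihilation k ^ 2))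
      (fun k => Pi.single k 2) (fun k => ((r k / 2 : ℝ) : ℂ))
      (fun k n => Real.sqrt (n k + 1) * Real.sqrt (n k + 2))
      (fun k n => Real.sqrt (n k) * Real.sqrt ((n k - 1 : ℕ) : ℝ)) where
  apply_single n := by
    rw [LinearMap.smul_apply, LinearMap.sum_apply, Finset.smul_sum]
    refine Finset.sum_congr rfl fun k _ => ?_
    have h1 : (n + Pi.single k 1 + Pi.single k 1 : Occ m) = n + Pi.single k 2 := by
      rw [add_assoc, ← Pi.single_add]
    have h2 : (n - Pi.single k 1 - Pi.single k 1 : Occ m) = n - Pi.single k 2 := by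
      rw [tsub_tsub, ← Pi.single_add]
    have h3 : (((n + Pi.single k 1 : Occ m) k : ℕ) : ℝ) + 1 = n k + 2 := by
      simp
      ring
    have h4 : (n - Pi.single k 1 : Occ m) k = n k - 1 := by simp
    simp only [LinearMap.sub_apply, LinearMap.smul_apply, pow_two, Module.End.mul_apply,
      creation_single, annihilation_single, map_smul, h1, h2, h3, h4, smul_smul, smul_sub,
      Complex.conj_ofReal]
    push_cast
    congr 2 <;> ring
  lower_add k n := by
    simp only [Pi.add_apply, Pi.single_eq_same]
    rw [mul_comm]
    congr 2
    · rw [show n k + 2 - 1 = n k + 1 by omega]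
      push_cast
      rfl
    · push_cast
      rfl
  lower_eq_zero k n h := by
    have := not_single_le h
    simp [show n k - 1 = 0 by omega]

/-- The Young parameter `s` stays free because its best value depends on the current energy. -/
lemma cappedRate_displacement_le {m : ℕ} {α : Fin m → ℂ} {a s : ℝ} (hα : ∀ k, ‖α k‖ ≤ a)
    (ha : 0 ≤ a) (hs : 0 < s) (M : ℕ) (ψ : FockSpace m) :
    cappedRate M (∑ k, (α k • creation k - conj (α k) • annihilation k)) ψ ≤
      a * s * cappedEnergy M ψ + m * (a / s) * ‖ψ‖ ^ 2 := by
  refine (isHopping_displacement α).cappedRate_le M ψ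
    -- A hop from `n` changes the capped number only if `|n| < M`. The weight `p` sits at the upper
    -- end `n + eₖ`, hence its cutoff `|n| ≤ M`.
    (fun k n => if n.total ≤ M then a * s * n k else 0)
    (fun _ n => if n.total < M then a / s else 0) _ _ ?_ ?_ ?_ ?_
  · intro k n
    positivity
  · intro k n
    positivity
  · intro k n x y hx hy
    rw [total_add_single]
    by_cases h : n.total < M
    · have h1 : ((M - n.total : ℕ) : ℝ) - (M - (n.total + 1) : ℕ) = 1 := by
        rw [sub_eq_iff_eq_add]
        norm_cast
        omega
      rw [h1, if_pos (by omega), if_pos h, abs_one, mul_one, abs_of_nonneg (Real.sqrt_nonneg _)]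
      simp only [Pi.add_apply, Pi.single_eq_same]
      push_cast
      have h2 : ((n k : ℝ) + 1) = Real.sqrt (n k + 1) ^ 2 := (Real.sq_sqrt (by positivity)).symm
      rw [h2, Real.sqrt_sq (Real.sqrt_nonneg _)]
      set u := Real.sqrt (n k + 1)
      have hu : 0 ≤ u := Real.sqrt_nonneg _
      have h3 : a * s * u ^ 2 * x ^ 2 + a / s * y ^ 2 - 2 * (a * u) * x * y =
          a * ((s * u * x - y) ^ 2 / s) := by
        field_simp
        ring
      have h4 : 0 ≤ a * ((s * u * x - y) ^ 2 / s) := by positivity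
      have h5 : 2 * (‖α k‖ * u) * x * y ≤ 2 * (a * u) * x * y := by
        gcongr
        exact hα k
      linarith
    · have h1 : M - n.total = 0 := by omega
      have h2 : M - (n.total + 1) = 0 := by omega
      rw [h1, h2, sub_self, abs_zero, if_neg (by omega), if_neg h]
      simp
  · intro n
    have hq : (if n.total < M then a / s else 0) ≤ a / s := by
      split_ifs
      · rfl
      · positivity
    rw [Finset.sum_add_distrib, Finset.sum_const, Finset.card_univ, Fintype.card_fin, nsmul_eq_mul]
    refine add_le_add ?_ (mul_le_mul_of_nonneg_left hq (Nat.cast_nonneg m))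
    by_cases h : n.total ≤ M
    · have hN : (∑ k, (n k : ℝ)) = n.total := by simp [Occ.total]
      simp only [if_pos h, min_eq_left h, ← Finset.mul_sum, hN]
      rfl
    · simp only [if_neg h, Finset.sum_const_zero]
      positivity

lemma cappedRate_squeezing_le {m : ℕ} {r : Fin m → ℝ} {R : ℝ} (hr0 : ∀ k, 0 ≤ r k)
    (hr : ∀ k, r k ≤ R) (hR : 0 ≤ R) {M : ℕ} (hM : 1 ≤ M) (ψ : FockSpace m) :
    cappedRate M
      ((1 / 2 : ℂ) • ∑ k, ((r k : ℂ) • creation k ^ 2 - conj (r k : ℂ) • annihilation k ^ 2)) ψ ≤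
      2 * R * cappedEnergy M ψ + R * m * ‖ψ‖ ^ 2 := by
  refine (isHopping_squeezing r).cappedRate_le M ψ
    -- The weights come from `2uv·xy ≤ v²x² + u²y²` with `u² = nₖ + 1` and `v² = nₖ + 2`, times the
    -- change of the capped number over the hop. Well below the cap they add up to `R/2 · (4|n| +
    -- 2m)`.
    (fun k n => R / 2 * (min n.total M - min (n.total - 2) M : ℕ) * n k)
    (fun k n => R / 2 * (min (n.total + 2) M - min n.total M : ℕ) * (n k + 1)) _ _ ?_ ?_ ?_ ?_
  · intro k n
    positivity
  · intro k n
    positivity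
  · intro k n x y hx hy
    rw [total_add_single]
    have h1 : ((M - n.total : ℕ) : ℝ) - (M - (n.total + 2) : ℕ) =
        (min (n.total + 2) M - min n.total M : ℕ) := by
      rw [sub_eq_iff_eq_add]
      norm_cast
      omega
    rw [h1, add_tsub_cancel_right, Nat.abs_cast, Complex.norm_real, Real.norm_of_nonneg
      (by linarith [hr0 k]), abs_of_nonneg (by positivity)]
    set δ : ℝ := ((min (n.total + 2) M - min n.total M : ℕ) : ℝ)
    have hδ : 0 ≤ δ := Nat.cast_nonneg _
    simp only [Pi.add_apply, Pi.single_eq_same]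
    push_cast
    have hu2 : Real.sqrt (n k + 1) ^ 2 = (n k : ℝ) + 1 := Real.sq_sqrt (by positivity)
    have hv2 : Real.sqrt (n k + 2) ^ 2 = (n k : ℝ) + 2 := Real.sq_sqrt (by positivity)
    set u := Real.sqrt (n k + 1)
    set v := Real.sqrt (n k + 2)
    have hu : 0 ≤ u := Real.sqrt_nonneg _
    have hv : 0 ≤ v := Real.sqrt_nonneg _
    have h5 : 2 * (r k / 2 * (u * v) * δ) * x * y ≤ 2 * (R / 2 * (u * v) * δ) * x * y := by
      gcongr
      exact hr k
    have h6 : 0 ≤ R / 2 * δ * (v * x - u * y) ^ 2 := by positivity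
    rw [← hu2, ← hv2]
    linarith
  · intro n
    have hN : (∑ k, (n k : ℝ)) = n.total := by simp [Occ.total]
    rw [Finset.sum_add_distrib, ← Finset.mul_sum, ← Finset.mul_sum, Finset.sum_add_distrib, hN]
    simp only [Finset.sum_const, Finset.card_univ, Fintype.card_fin, nsmul_eq_mul, mul_one]
    have h1 : (min n.total M - min (n.total - 2) M) * n.total ≤ 2 * min n.total M := by
      rcases le_or_gt n.total M with h | h
      · rw [min_eq_left h]
        exact Nat.mul_le_mul_right _ (by omega)
      · rcases eq_or_lt_of_le (Nat.succ_le_of_lt h) with h | h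
        -- Boundary case `|n| = M + 1`: the bound becomes `M + 1 ≤ 2M`, which requires `M ≥ 1`.
        · rw [show min n.total M - min (n.total - 2) M = 1 by omega]
          omega
        · rw [show min n.total M - min (n.total - 2) M = 0 by omega]
          omega
    have h2 : (min (n.total + 2) M - min n.total M) * (n.total + m) ≤
        2 * min n.total M + 2 * m := by
      rcases lt_or_ge n.total M with h | h
      · rw [min_eq_left h.le, ← mul_add]
        exact Nat.mul_le_mul_right _ (by omega)
      · rw [show min (n.total + 2) M - min n.total M = 0 by omega]
        omega
    have h3 : ((min n.total M - min (n.total - 2) M : ℕ) : ℝ) * n.total ≤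
        2 * (min n.total M : ℕ) := by exact_mod_cast h1
    have h4 : ((min (n.total + 2) M - min n.total M : ℕ) : ℝ) * (n.total + m) ≤
        2 * (min n.total M : ℕ) + 2 * m := by exact_mod_cast h2
    have h5 := mul_le_mul_of_nonneg_left (add_le_add h3 h4) (by linarith : 0 ≤ R / 2)
    linarith

/-- Grönwall: the shift `m/2` absorbs the inhomogeneous term of the rate, leaving `f' ≤ 2R f`. -/
lemma IsSqueezing.cappedEnergy_le {m : ℕ} {r : Fin m → ℝ} {R : ℝ} (hr0 : ∀ k, 0 ≤ r k)
    (hr : ∀ k, r k ≤ R) (hR : 0 ≤ R) {S : FockUnitary m}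
    (hS : IsSqueezing (fun k => (r k : ℂ)) S) {M : ℕ} (hM : 1 ≤ M) {ψ : FockSpace m}
    (hψ : ‖ψ‖ = 1) :
    cappedEnergy M (S ψ) + m / 2 ≤ Real.exp (2 * R) * (cappedEnergy M ψ + m / 2) := by
  obtain ⟨U, h0, hadd, -, hd, rfl⟩ := hS
  have hanti : Antitone fun t => (cappedEnergy M (U t ψ) + m / 2) * Real.exp (-(2 * R) * t) := by
    refine antitone_of_hasDerivAt_nonpos (fun t => ((hasDerivAt_cappedEnergy hadd hd M ψ t).add_const
      ((m : ℝ) / 2)).mul (((hasDerivAt_id t).const_mul (-(2 * R))).exp)) fun t => ?_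
    have h1 := cappedRate_squeezing_le hr0 hr hR hM (U t ψ)
    rw [LinearIsometryEquiv.norm_map, hψ] at h1
    have h2 := mul_le_mul_of_nonneg_right h1 (Real.exp_pos (-(2 * R) * t)).le
    simp only [id, Pi.zero_apply]
    linarith
  have h1 := hanti zero_le_one
  simp only [h0, mul_one, mul_zero, Real.exp_zero, Real.exp_neg] at h1
  rw [← div_eq_mul_inv, div_le_iff₀ (Real.exp_pos _)] at h1
  rw [mul_comm]
  exact h1

/-- The shift by `m` keeps the argument of the square root positive, so that it is differentiable
even at zero energy. -/
lemma IsDisplacement.cappedEnergy_le {m : ℕ} (hm : 1 ≤ m) {α : Fin m → ℂ} {a : ℝ}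
    (hα : ∀ k, ‖α k‖ ≤ a) (ha : 0 ≤ a) {D : FockUnitary m} (hD : IsDisplacement α D) (M : ℕ)
    {ψ : FockSpace m} (hψ : ‖ψ‖ = 1) :
    Real.sqrt (cappedEnergy M (D ψ) + m) ≤ Real.sqrt (cappedEnergy M ψ + m) + a * Real.sqrt m := by
  obtain ⟨U, h0, hadd, -, hd, rfl⟩ := hD
  have hm0 : (0 : ℝ) < m := by exact_mod_cast hm
  have hpos (t : ℝ) : 0 < cappedEnergy M (U t ψ) + m := by
    linarith [cappedEnergy_nonneg M (U t ψ)]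
  have hanti : Antitone fun t => Real.sqrt (cappedEnergy M (U t ψ) + m) - a * Real.sqrt m * t := by
    refine antitone_of_hasDerivAt_nonpos (fun t => (((hasDerivAt_cappedEnergy hadd hd M ψ
      t).add_const (m : ℝ)).sqrt (hpos t).ne').sub
        ((hasDerivAt_id t).const_mul (a * Real.sqrt m))) fun t => ?_
    have hb2 : Real.sqrt m ^ 2 = m := Real.sq_sqrt hm0.le
    have hy2 := Real.sq_sqrt (hpos t).le
    have hb : 0 < Real.sqrt m := Real.sqrt_pos.mpr hm0
    have hy := Real.sqrt_pos.mpr (hpos t)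
    -- The choice `s = √m / y` balances the two terms `a s y²` and `m a / s`; each equals `a √m y`.
    have h1 := cappedRate_displacement_le hα ha (div_pos hb hy) M (U t ψ)
    rw [LinearIsometryEquiv.norm_map, hψ] at h1
    set b := Real.sqrt m
    set y := Real.sqrt (cappedEnergy M (U t ψ) + m)
    have h2 : cappedEnergy M (U t ψ) ≤ y ^ 2 := by linarith
    have h3 : a * (b / y) * cappedEnergy M (U t ψ) ≤ a * (b / y) * y ^ 2 := by gcongr
    have h4 : a * (b / y) * y ^ 2 + m * (a / (b / y)) * 1 ^ 2 = a * b * (2 * y) := by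
      rw [← hb2]
      field_simp
      ring
    simp only [mul_one, Pi.zero_apply, sub_nonpos]
    rw [div_le_iff₀ (by positivity)]
    linarith
  have h1 := hanti zero_le_one
  simp only [h0, mul_one, mul_zero, sub_zero] at h1
  exact sub_le_iff_le_add.mp h1

/-! ### Circuits -/

lemma meanEnergy_layer_le {m : ℕ} (hm : 1 ≤ m) {α : Fin m → ℂ} {r : Fin m → ℝ} {a R X : ℝ}
    (hα : ∀ k, ‖α k‖ ≤ a) (ha : 0 ≤ a) (hr : ∀ k, r k ≤ R) (hR : 0 ≤ R) {G χ : FockUnitary m}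
    (hG : IsGaussianGate α r G) (hχ : IsEnergyPreserving χ) {ψ : FockSpace m} (hψ : ‖ψ‖ = 1)
    (hX : 0 ≤ X) (h : meanEnergy ψ ≤ ENNReal.ofReal X) :
    meanEnergy (G (χ ψ)) ≤ ENNReal.ofReal
      ((Real.exp (2 * R) + 4 * a * Real.exp R) * (X + m) - m + m * a ^ 2) := by
  obtain ⟨-, hr0, V, D, S, U, hV, hD, hS, hU, rfl⟩ := hG
  change meanEnergy (V (D (S (U (χ ψ))))) ≤ _
  rw [hV.2.meanEnergy_map]
  rw [← hχ.meanEnergy_map, ← hU.2.meanEnergy_map] at h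
  have hφ : ‖U (χ ψ)‖ = 1 := by simp [hψ]
  have hSφ : ‖S (U (χ ψ))‖ = 1 := by simp [hψ]
  refine meanEnergy_le_of_cappedEnergy_le fun M hM => ?_
  have h1 := Bosonic.cappedEnergy_le M hX h
  have h2 := hS.cappedEnergy_le hr0 hr hR hM hφ
  have h3 := hD.cappedEnergy_le hm hα ha M hSφ
  set F := cappedEnergy M (U (χ ψ))
  set Y := cappedEnergy M (S (U (χ ψ)))
  set Z := cappedEnergy M (D (S (U (χ ψ))))
  have hY : 0 ≤ Y := cappedEnergy_nonneg _ _
  have hZ : 0 ≤ Z := cappedEnergy_nonneg _ _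
  have hm0 : (0 : ℝ) < m := by exact_mod_cast hm
  have hE : Real.exp (2 * R) = Real.exp R ^ 2 := by rw [← Real.exp_nat_mul]; norm_num
  have hE1 : 1 ≤ Real.exp R := Real.one_le_exp hR
  rw [hE] at h2 ⊢
  set E := Real.exp R
  have hYX : Y + m ≤ E ^ 2 * (X + m) := by
    have h4 : E ^ 2 * (F + m / 2) ≤ E ^ 2 * (X + m / 2) := by gcongr
    -- Passing from the squeezing shift `m/2` to the displacement shift `m` costs nothing, because
    -- `E ≥ 1`.
    have h5 : 1 * ((m : ℝ) / 2) ≤ E ^ 2 * (m / 2) := by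
      gcongr
      exact one_le_pow₀ hE1
    linarith
  have hsm := Real.sqrt_nonneg (m : ℝ)
  have hsq1 : Real.sqrt (Y + m) ≤ E * Real.sqrt (X + m) := by
    refine Real.sqrt_le_iff.mpr ⟨by positivity, ?_⟩
    rwa [mul_pow, Real.sq_sqrt (by positivity)]
  have hsq2 : Real.sqrt m ≤ Real.sqrt (X + m) := Real.sqrt_le_sqrt (by linarith)
  have hsq : Real.sqrt (Y + m) * Real.sqrt m ≤ E * (X + m) := by
    calc Real.sqrt (Y + m) * Real.sqrt m ≤ E * Real.sqrt (X + m) * Real.sqrt (X + m) := by gcongr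
      _ = E * (X + m) := by rw [mul_assoc, Real.mul_self_sqrt (by positivity)]
  have h6 : Z + m ≤ (Real.sqrt (Y + m) + a * Real.sqrt m) ^ 2 := (Real.sqrt_le_left
    (by positivity)).mp h3
  have h7 : (Real.sqrt (Y + m) + a * Real.sqrt m) ^ 2 =
      (Y + m) + 2 * a * (Real.sqrt (Y + m) * Real.sqrt m) + a ^ 2 * m := by
    rw [add_sq, mul_pow, Real.sq_sqrt (by positivity), Real.sq_sqrt hm0.le]
    ring
  have h8 := mul_le_mul_of_nonneg_left hsq ha
  -- The square produces the cross term `2 a E (X + m)`; this nonnegative quantity fills the gap to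
  -- the coefficient `4` in the statement.
  have h9 : 0 ≤ a * (E * (X + m)) := by positivity
  linarith

lemma norm_circuitState {m : ℕ} : ∀ {L : ℕ} (G χ : Fin L → FockUnitary m),
    ‖circuitState G χ‖ = 1
  | 0, _, _ => by simp [circuitState]
  | L + 1, G, χ => by
    rw [circuitState, Fin.foldl_succ_last, LinearIsometryEquiv.norm_map,
      LinearIsometryEquiv.norm_map]
    exact norm_circuitState (fun i => G i.castSucc) fun i => χ i.castSucc

/-- The bound solves `X ↦ A (X + m) - m + m a²` from `X = 0`. Keeping the geometric sum unevaluated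
avoids dividing by `A - 1`, so `A = 1` needs no separate induction. -/
lemma meanEnergy_circuitState_le {m : ℕ} (hm : 1 ≤ m) {a R A : ℝ} (ha : 0 ≤ a) (hR : 0 ≤ R)
    (hA : A = Real.exp (2 * R) + 4 * a * Real.exp R) (hA1 : 1 ≤ A) :
    ∀ {L : ℕ} {α : Fin L → Fin m → ℂ} {r : Fin L → Fin m → ℝ} {G χ : Fin L → FockUnitary m},
      (∀ i k, ‖α i k‖ ≤ a) → (∀ i k, r i k ≤ R) → (∀ i, IsGaussianGate (α i) (r i) (G i)) →
      (∀ i, IsEnergyPreserving (χ i)) →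
      meanEnergy (circuitState G χ) ≤
        ENNReal.ofReal (m * (A ^ L - 1) + m * a ^ 2 * ∑ i ∈ Finset.range L, A ^ i)
  | 0, _, _, _, _ => fun _ _ _ _ => by simp [circuitState, meanEnergy_vacuum]
  | L + 1, α, r, G, χ => fun hα hr hG hχ => by
    have ih := meanEnergy_circuitState_le hm ha hR hA hA1 (fun i k => hα (Fin.castSucc i) k)
      (fun i k => hr (Fin.castSucc i) k) (fun i => hG (Fin.castSucc i))
      (fun i => hχ (Fin.castSucc i))
    have hX : 0 ≤ m * (A ^ L - 1) + m * a ^ 2 * ∑ i ∈ Finset.range L, A ^ i := by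
      have : 0 ≤ A ^ L - 1 := sub_nonneg.mpr (one_le_pow₀ hA1)
      positivity
    rw [circuitState, Fin.foldl_succ_last]
    refine (meanEnergy_layer_le hm (hα (Fin.last L)) ha (hr (Fin.last L)) hR (hG (Fin.last L))
      (hχ (Fin.last L)) (norm_circuitState (fun i => G i.castSucc) fun i => χ i.castSucc) hX
      ih).trans_eq ?_
    rw [← hA, Finset.sum_range_succ', ← Finset.sum_congr rfl fun i _ => (pow_succ' A i).symm,
      ← Finset.mul_sum]
    congr 1
    ring

end Bosonic

end

theorem mainTheorem9 (m L : ℕ) (hm : 1 ≤ m) (hL : 1 ≤ L)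
    (α : Fin L → Fin m → ℂ) (r : Fin L → Fin m → ℝ)
    (ψ : Bosonic.FockSpace m) (hψ : ψ ∈ Bosonic.outputStates α r)
    (αmax rmax A : ℝ)
    (hα : IsGreatest (Set.range fun p : Fin L × Fin m => ‖α p.1 p.2‖) αmax)
    (hr : IsGreatest (Set.range fun p : Fin L × Fin m => r p.1 p.2) rmax)
    (hA : A = Real.exp (2 * rmax) + 4 * αmax * Real.exp rmax) :
    Bosonic.meanEnergy ψ ≤
      ENNReal.ofReal (m * (A ^ L - 1) * (1 + αmax ^ 2 / (A - 1))) := by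
  obtain ⟨G, χ, hG, hχ, rfl⟩ := hψ
  have ha : 0 ≤ αmax := by
    obtain ⟨p, hp⟩ := hα.1
    exact hp ▸ norm_nonneg _
  have hR : 0 ≤ rmax := by
    obtain ⟨p, hp⟩ := hr.1
    exact hp ▸ (hG p.1).2.1 p.2
  have hE : 1 ≤ Real.exp (2 * rmax) := Real.one_le_exp (by linarith)
  have h4 : αmax * 1 ≤ αmax * Real.exp rmax := by
    gcongr
    exact Real.one_le_exp hR
  have hA1 : 1 ≤ A := by linarith
  refine (Bosonic.meanEnergy_circuitState_le hm ha hR hA hA1 (fun i k => hα.2 ⟨(i, k), rfl⟩)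
    (fun i k => hr.2 ⟨(i, k), rfl⟩) hG hχ).trans_eq ?_
  congr 1
  rcases hA1.eq_or_lt with h | h
  -- `A ≥ 1 + 4 αmax`, so `A = 1` forces `αmax = 0`. Both sides are then zero, whatever value the
  -- division by `A - 1 = 0` takes.
  · have : αmax = 0 := by linarith
    simp [this, ← h]
  · rw [geom_sum_eq h.ne']
    field_simp [(sub_pos.mpr h).ne']
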